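/- Let $d,m$ be positive integers, let $f,g_1,\dots,g_m:\mathbb R^d\to\mathbb R^d$ be continuously differentiable and let $u=(u_1,\dots,u_m):\mathbb R^d\to\mathbb R^m$ be a feedback such that each product $x\mapsto u_k(x)g_k(x)$ is locally Lipschitz. Put $F(x)=f(x)+\sum_{k=1}^m u_k(x)g_k(x)$. Assume that $f(0)=0$ and $u_k(0)=0$ for every $k$, that $F$ is twice continuously differentiable in a neighbourhood of $0$, and that $0$ is a hyperbolic (the derivative $DF(0)$ has no eigenvalue on the imaginary axis) and locally asymptotically stable equilibrium of $\dot x=F(x)$. Let $R$ be the basin of attraction of $0$ for $\dot x=F(x)$, i.e. the set of initial states whose trajectory exists for all forward time and converges to $0$. Let $V:R\to[0,\infty)$ be continuously differentiable with $V(0)=0$ and $V(x)>0$ for $x\in R\setminus\{0\}$, such that $V(x)\to+\infty$ as $x\in R$ tends to a boundary point of $R$ or as $x\in R$, $\|x\|\to\infty$, and such that $t\mapsto V(x(t))$ is strictly decreasing on $[0,\infty)$ along every trajectory $x(\cdot)$ of $\dot x=F(x)$ starting at time $0$ in $R\setminus\{0\}$. Fix $T>0$. A switching time is a non-increasing function $\tau:[0,\infty)\to(0,\infty)$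 that is constant on each interval $[nT,(n+1)T)$, $n=0,1,2,\dots$, and satisfies $\tau(t)\to0$ as $t\to\infty$; it dominates the switching time $\tau'$ if $\tau(t)\le\tau'(t)$ for all $t\ge0$. For a switching time $\tau$ and $t\ge 0$ let $$\sigma(t;\tau)=1+\left\lfloor\frac{t-m\tau(t)\left\lfloor \frac{t}{m\tau(t)}\right\rfloor}{\tau(t)}\right\rfloor\in\{1,\dots,m\}.$$ Then for every $\theta>0$ there is a switching time $\tau'=\tau'(\cdot\,;\theta)$ such that for every initial time $t_0\ge0$, every $\bar x\in R$ with $V(\bar x)\le\theta$, and every switching time $\tau$ that dominates $\tau'$, the round-robin scheduled system $$\dot z(t)=f(z(t))+m\,g_{\sigma(t-t_0;\tau)}(z(t))\,u_{\sigma(t-t_0;\tau)}(z(t)),\qquad z(t_0)=\bar x,$$ has a (Carathéodory) solution on $[t_0,\infty)$, and every such solution satisfies $z(t)\to0$ as $t\to\infty$. -/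

import Mathlib

open Filter Topology Set MeasureTheory

noncomputable section

namespace RoundRobin

/-- A Carathéodory solution on `[t₀, ∞)` of `ẋ(t) = X(t, x(t))`, `x(t₀) = ξ`, in integral form:
`x` is continuous on `[t₀, ∞)`, `s ↦ X(s, x(s))` is integrable on every `[t₀, t]`, and
`x(t) = ξ + ∫_{t₀}^t X(s, x(s)) ds` for all `t ≥ t₀`.
Values of `x` before `t₀` are irrelevant. -/
def IsSolution {d : ℕ} (X : ℝ → EuclideanSpace ℝ (Fin d) → EuclideanSpace ℝ (Fin d)) (t₀ : ℝ)
    (ξ : EuclideanSpace ℝ (Fin d)) (x : ℝ → EuclideanSpace ℝ (Fin d)) : Prop :=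
  ContinuousOn x (Ici t₀) ∧
    ∀ t, t₀ ≤ t → IntervalIntegrable (fun s => X s (x s)) volume t₀ t ∧
      x t = ξ + ∫ s in t₀..t, X s (x s)

/-- The nominal closed-loop vector field `F = f + ∑ₖ gₖ uₖ`. -/
def closedLoop {d m : ℕ} (f : EuclideanSpace ℝ (Fin d) → EuclideanSpace ℝ (Fin d))
    (g : Fin m → EuclideanSpace ℝ (Fin d) → EuclideanSpace ℝ (Fin d))
    (u : Fin m → EuclideanSpace ℝ (Fin d) → ℝ) (x : EuclideanSpace ℝ (Fin d)) :
    EuclideanSpace ℝ (Fin d) :=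
  f x + ∑ k, u k x • g k x

/-- Basin of attraction of the origin for the autonomous system `ẋ = F(x)`: the initial states
from which there is a solution on `[0, ∞)` that converges to `0`. -/
def basin {d : ℕ} (F : EuclideanSpace ℝ (Fin d) → EuclideanSpace ℝ (Fin d)) :
    Set (EuclideanSpace ℝ (Fin d)) :=
  {ξ | ∃ x, IsSolution (fun _ => F) 0 ξ x ∧ Tendsto x atTop (𝓝 0)}

/-- The origin is a locally asymptotically stable equilibrium of `ẋ = F(x)`:
equilibrium, Lyapunov stable, and locally attractive. -/
structure IsLocallyAsymptoticallyStable {d : ℕ}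
    (F : EuclideanSpace ℝ (Fin d) → EuclideanSpace ℝ (Fin d)) : Prop where
  equilibrium : F 0 = 0
  stable : ∀ ε > 0, ∃ δ > 0, ∀ ξ, ‖ξ‖ ≤ δ →
    ∃ x, IsSolution (fun _ => F) 0 ξ x ∧ ∀ t, 0 ≤ t → ‖x t‖ ≤ ε
  attractive : ∃ δ > 0, Metric.closedBall 0 δ ⊆ basin F

/-- The linearization of `F` at the origin has no (complex) eigenvalue on the imaginary axis. -/
def IsHyperbolic {d : ℕ} (F : EuclideanSpace ℝ (Fin d) → EuclideanSpace ℝ (Fin d)) : Prop :=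
  DifferentiableAt ℝ F 0 ∧
    ∀ μ : ℂ, Polynomial.aeval μ
      (LinearMap.charpoly
        (fderiv ℝ F 0 : EuclideanSpace ℝ (Fin d) →ₗ[ℝ] EuclideanSpace ℝ (Fin d))) = 0 → μ.re ≠ 0

/-- `V` is a continuously differentiable, positive definite function on the basin of attraction
that tends to `+∞` at the boundary of the basin (including at infinity, if the basin is unbounded)
and decreases strictly along the nonzero trajectories of `ẋ = F(x)` in the basin.
Values of `V` outside the basin are irrelevant. -/
structure IsLyapunovFunction {d : ℕ}
    (F : EuclideanSpace ℝ (Fin d) → EuclideanSpace ℝ (Fin d))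
    (V : EuclideanSpace ℝ (Fin d) → ℝ) : Prop where
  contDiffOn : ContDiffOn ℝ 1 V (basin F)
  zero : V 0 = 0
  pos : ∀ x ∈ basin F, x ≠ 0 → 0 < V x
  tendsto_frontier : ∀ p ∈ frontier (basin F), Tendsto V (𝓝[basin F] p) atTop
  tendsto_infinity :
    Tendsto V (cocompact (EuclideanSpace ℝ (Fin d)) ⊓ 𝓟 (basin F)) atTop
  strictAnti : ∀ ξ ∈ basin F, ξ ≠ 0 → ∀ x, IsSolution (fun _ => F) 0 ξ x →
    StrictAntiOn (fun t => V (x t)) (Ici 0)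

/-- A switching-time function `τ : [0, ∞) → (0, ∞)`: non-increasing, constant on each interval
`[nT, (n+1)T)`, and tending to `0`. Values at negative times are irrelevant. -/
structure IsSwitchingTime (T : ℝ) (τ : ℝ → ℝ) : Prop where
  pos : ∀ t, 0 ≤ t → 0 < τ t
  antitone : AntitoneOn τ (Ici 0)
  piecewise_const : ∀ n : ℕ, ∀ t ∈ Ico (n * T) ((n + 1) * T), τ t = τ (n * T)
  tendsto_zero : Tendsto τ atTop (𝓝 0)

/-- The round-robin switching scheme
`σ(t; τ) = 1 + ⌊(t - m τ(t) ⌊t / (m τ(t))⌋) / τ(t)⌋`, with values in `{1, …, m}` for `t ≥ 0`. -/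
def switchIndex (m : ℕ) (τ : ℝ → ℝ) (t : ℝ) : ℤ :=
  1 + ⌊(t - m * τ t * ⌊t / (m * τ t)⌋) / τ t⌋

/-- The scheduled vector field `f(x) + m g_σ(x) u_σ(x)` with `σ = σ(t - t₀; τ)`; the channels
are indexed by `Fin m`, so that the `j`-th channel, `1 ≤ j ≤ m`, is the index with value `j - 1`. -/
def scheduled {d m : ℕ} (f : EuclideanSpace ℝ (Fin d) → EuclideanSpace ℝ (Fin d))
    (g : Fin m → EuclideanSpace ℝ (Fin d) → EuclideanSpace ℝ (Fin d))
    (u : Fin m → EuclideanSpace ℝ (Fin d) → ℝ) (τ : ℝ → ℝ) (t₀ t : ℝ)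
    (x : EuclideanSpace ℝ (Fin d)) : EuclideanSpace ℝ (Fin d) :=
  f x + (m : ℝ) • ∑ k : Fin m,
    if switchIndex m τ (t - t₀) = (k : ℤ) + 1 then u k x • g k x else 0

end RoundRobin

end

/-! The argument is averaging with a Lyapunov function sampled once per window of length `T`. On a
window the switching time is a constant `p`, and the scheduled field is the nominal `F` plus terms
`w_k(t) u_k g_k`, where `w_k` has period `m p` and mean zero. Integrated along a nominal trajectory,
which is Lipschitz in time, such a term contributes only `O(p)` (`norm_integral_periodic_smul_le`).
By Grönwall, the scheduled solution stays within `C p` of the nominal solution restarted at the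
beginning of the window (`norm_scheduled_solution_sub_le`).

Let `Φ` be the nominal time-`T` map on the sublevel set `S = {V ≤ θ}`, which is compact because `V`
blows up at the boundary and at infinity. Strict decrease of `V` puts the compact set `Φ(S)` inside
the open set `{V < θ}`, with a margin `η`. If `C τ ≤ η`, the samples `y(nT)` therefore never leave
`S`, and they form an orbit of `Φ` with errors `C τ(nT) → 0`. A strict Lyapunov function forces such
a perturbed orbit to `0` (`tendsto_zero_of_asymptotic_orbit`), and the window estimate carries the
convergence to all times.

Solutions are first built for globally Lipschitz extensions of the data. They remain where nothing
was changed, and local uniqueness gives the claim for every solution. -/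

namespace RoundRobin

open scoped NNReal BoundedContinuousFunction

/-! ### Grönwall's inequality and averaging of periodic weights -/

/-- Grönwall's inequality in integral form. -/
theorem le_mul_exp_of_le_add_integral {e : ℝ → ℝ} {a b ε L : ℝ} (he : ContinuousOn e (Icc a b))
    (he0 : ∀ t ∈ Icc a b, 0 ≤ e t) (hL : 0 ≤ L)
    (h : ∀ t ∈ Icc a b, e t ≤ ε + L * ∫ s in a..t, e s) {t : ℝ} (ht : t ∈ Icc a b) :
    e t ≤ ε * Real.exp (L * (t - a)) := by
  have hab : a ≤ b := ht.1.trans ht.2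
  -- A continuous extension to the whole line makes the primitive differentiable everywhere,
  -- endpoints included.
  set e' : ℝ → ℝ := IccExtend hab ((Icc a b).domRestrict e) with he'
  have hcont : Continuous e' := (continuousOn_iff_continuous_domRestrict.1 he).Icc_extend'
  have heq : ∀ s ∈ Icc a b, e' s = e s := fun s hs => by
    rw [he', IccExtend_of_mem hab _ hs]; rfl
  have hint : ∀ s ∈ Icc a b, ∫ r in a..s, e r = ∫ r in a..s, e' r := fun s hs => by
    refine intervalIntegral.integral_congr fun r hr => ?_
    rw [uIcc_of_le hs.1] at hr
    exact (heq r ⟨hr.1, hr.2.trans hs.2⟩).symm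
  have hder : ∀ s, HasDerivAt (fun s => ∫ r in a..s, e' r) (e' s) s := fun s =>
    intervalIntegral.integral_hasDerivAt_right (hcont.intervalIntegrable _ _)
      (hcont.stronglyMeasurableAtFilter _ _) hcont.continuousAt
  have hpos : ∀ s ∈ Icc a b, 0 ≤ ∫ r in a..s, e' r := fun s hs => by
    rw [← hint s hs]
    exact intervalIntegral.integral_nonneg hs.1 fun r hr => he0 r ⟨hr.1, hr.2.trans hs.2⟩
  have hG := norm_le_gronwallBound_of_norm_deriv_right_le (f := fun s => ∫ r in a..s, e' r)
    (f' := e') (δ := 0) (K := L) (ε := ε) (a := a) (b := b)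
    (fun s _ => (hder s).continuousAt.continuousWithinAt) (fun s _ => (hder s).hasDerivWithinAt)
    (by simp) (fun s hs => by
      have hs' := Ico_subset_Icc_self hs
      rw [heq s hs', Real.norm_of_nonneg (he0 s hs'), Real.norm_of_nonneg (hpos s hs'),
        ← hint s hs']
      linarith [h s hs']) t ht
  rw [Real.norm_of_nonneg (hpos t ht)] at hG
  have h1 := h t ht
  rw [hint t ht] at h1
  rcases hL.eq_or_lt with rfl | hL
  · simpa using h1
  · rw [gronwallBound_of_K_ne_0 hL.ne'] at hG
    have h2 := mul_le_mul_of_nonneg_left hG hL.le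
    have h3 : L * (0 * Real.exp (L * (t - a)) + ε / L * (Real.exp (L * (t - a)) - 1)) =
        ε * (Real.exp (L * (t - a)) - 1) := by
      field_simp
      ring
    linarith

/-- The integral of a Lipschitz function against a periodic weight of mean zero is of the order
of the period. -/
theorem norm_integral_periodic_smul_le {E : Type*} [NormedAddCommGroup E] [NormedSpace ℝ E]
    [CompleteSpace E] {w : ℝ → ℝ} {p W : ℝ} (hp : 0 < p)
    (hw : Function.Periodic w p) (hwm : Measurable w) (hwb : ∀ t, |w t| ≤ W)
    (hw0 : ∫ t in (0 : ℝ)..p, w t = 0) {ψ : ℝ → E} {a b M Λ : ℝ} (hab : a ≤ b)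
    (hψM : ∀ t ∈ Icc a b, ‖ψ t‖ ≤ M)
    (hψ : ∀ s ∈ Icc a b, ∀ t ∈ Icc a b, ‖ψ s - ψ t‖ ≤ Λ * |s - t|) (hΛ : 0 ≤ Λ) :
    ‖∫ t in a..b, w t • ψ t‖ ≤ W * M * p + W * Λ * p * (b - a) := by
  have hW : 0 ≤ W := (abs_nonneg _).trans (hwb 0)
  have hM : 0 ≤ M := (norm_nonneg _).trans (hψM a ⟨le_rfl, hab⟩)
  have hcont : ContinuousOn ψ (Icc a b) := by
    refine LipschitzOnWith.continuousOn (K := Real.toNNReal Λ) ?_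
    refine LipschitzOnWith.of_dist_le_mul fun s hs t ht => ?_
    rw [dist_eq_norm, Real.dist_eq, Real.coe_toNNReal _ hΛ]
    exact hψ s hs t ht
  have hwi : ∀ c d, IntervalIntegrable w volume c d := fun c d => by
    refine (intervalIntegrable_const (c := W)).mono_fun hwm.aestronglyMeasurable ?_
    exact .of_forall fun t => by simpa [abs_of_nonneg hW] using hwb t
  have hint : ∀ c d, a ≤ c → c ≤ d → d ≤ b → IntervalIntegrable (fun t => w t • ψ t) volume c d :=
    fun c d hc hcd hd => (hwi c d).smul_continuousOn
      (hcont.mono (by rw [uIcc_of_le hcd]; exact Icc_subset_Icc hc hd))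
  -- Whole periods are peeled off from the right. The leftover piece, shorter than a period, costs
  -- `W M p`; each full period costs `W Λ p · p`.
  suffices H : ∀ n : ℕ, ∀ b', a ≤ b' → b' ≤ b → b' - a ≤ n * p →
      ‖∫ t in a..b', w t • ψ t‖ ≤ W * M * p + W * Λ * p * (b' - a) by
    obtain ⟨n, hn⟩ := exists_nat_ge ((b - a) / p)
    exact H n b hab le_rfl (by rwa [div_le_iff₀ hp] at hn)
  intro n
  induction n with
  | zero =>
    intro b' h1 h2 h3
    have : b' = a := by simp at h3; linarith
    subst this
    simp
    positivity
  | succ n ih =>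
    intro b' h1 h2 h3
    rcases le_total (b' - a) p with hle | hle
    · have : ‖∫ t in a..b', w t • ψ t‖ ≤ W * M * |b' - a| := by
        refine intervalIntegral.norm_integral_le_of_norm_le_const fun t ht => ?_
        rw [uIoc_of_le h1] at ht
        rw [norm_smul]
        exact mul_le_mul (hwb t) (hψM t ⟨ht.1.le, ht.2.trans h2⟩) (norm_nonneg _) hW
      rw [abs_of_nonneg (by linarith)] at this
      have h4 : W * M * (b' - a) ≤ W * M * p := by gcongr
      have h5 : 0 ≤ W * Λ * p * (b' - a) := mul_nonneg (by positivity) (by linarith)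
      linarith
    · have hc1 : a ≤ b' - p := by linarith
      have hc2 : b' - p ≤ b' := by linarith
      rw [← intervalIntegral.integral_add_adjacent_intervals
        (hint a (b' - p) le_rfl hc1 (hc2.trans h2)) (hint (b' - p) b' hc1 hc2 h2)]
      -- Since the weight has mean zero, the constant `ψ b'` may be subtracted; what remains is at
      -- most `Λ p` on this period.
      have hz : ∫ t in (b' - p)..b', w t • ψ b' = 0 := by
        rw [intervalIntegral.integral_smul_const]
        have := hw.intervalIntegral_add_eq (b' - p) 0
        rw [sub_add_cancel, zero_add, hw0] at this
        rw [this, zero_smul]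
      have hlast : ‖∫ t in (b' - p)..b', w t • ψ t‖ ≤ W * (Λ * p) * |b' - (b' - p)| := by
        rw [← sub_zero (∫ t in (b' - p)..b', w t • ψ t), ← hz,
          ← intervalIntegral.integral_sub (hint _ _ hc1 hc2 h2)
            ((hwi _ _).smul_continuousOn continuousOn_const)]
        refine intervalIntegral.norm_integral_le_of_norm_le_const fun t ht => ?_
        rw [uIoc_of_le hc2] at ht
        rw [← smul_sub, norm_smul]
        refine mul_le_mul (hwb t) ?_ (norm_nonneg _) hW
        refine (hψ t ⟨hc1.trans ht.1.le, ht.2.trans h2⟩ b' ⟨h1, h2⟩).trans ?_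
        gcongr
        rw [abs_le]
        constructor <;> linarith [ht.1, ht.2]
      have hih := ih (b' - p) hc1 (hc2.trans h2) (by push_cast at h3; linarith)
      rw [sub_sub_cancel, abs_of_pos hp] at hlast
      calc _ ≤ _ := norm_add_le _ _
        _ ≤ _ := add_le_add hih hlast
        _ = _ := by ring

/-! ### Global existence by contraction in an exponentially weighted norm -/

/-- The primitive of `K e^{2Ks}` is `e^{2Ks} / 2`, so the weight `e^{-2Kt}` turns integration into a
gain of one half, uniformly in `t`. This is the contraction factor of the Picard map. -/
theorem exp_neg_mul_norm_integral_le {E : Type*} [NormedAddCommGroup E] [NormedSpace ℝ E]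
    {h : ℝ → E} {A K t : ℝ} (hA : 0 ≤ A) (ht : 0 ≤ t)
    (hh : ∀ s, ‖h s‖ ≤ A * (K * Real.exp (2 * K * s))) :
    Real.exp (-(2 * K * t)) * ‖∫ s in (0 : ℝ)..t, h s‖ ≤ A / 2 := by
  have hder : ∀ s ∈ uIcc 0 t, HasDerivAt (fun s => A / 2 * Real.exp (2 * K * s))
      (A * (K * Real.exp (2 * K * s))) s := fun s _ => by
    have h1 : HasDerivAt (fun s => 2 * K * s) (2 * K) s := by
      simpa using (hasDerivAt_id s).const_mul (2 * K)
    refine (h1.exp.const_mul (A / 2)).congr_deriv ?_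
    ring
  have hi : IntervalIntegrable (fun s => A * (K * Real.exp (2 * K * s))) volume 0 t :=
    Continuous.intervalIntegrable (by fun_prop) _ _
  have h1 := intervalIntegral.norm_integral_le_of_norm_le ht (.of_forall fun s _ => hh s) hi
  rw [intervalIntegral.integral_eq_sub_of_hasDerivAt hder hi] at h1
  have h2 : ‖∫ s in (0 : ℝ)..t, h s‖ ≤ A / 2 * Real.exp (2 * K * t) := by
    simp only [mul_zero, Real.exp_zero] at h1
    linarith
  calc _ ≤ Real.exp (-(2 * K * t)) * (A / 2 * Real.exp (2 * K * t)) := by gcongr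
    _ = A / 2 * (Real.exp (-(2 * K * t)) * Real.exp (2 * K * t)) := by ring
    _ = A / 2 := by rw [← Real.exp_add]; simp

/-- Global existence of Carathéodory solutions for uniformly Lipschitz right-hand sides. -/
theorem exists_isSolution {d : ℕ} {X : ℝ → EuclideanSpace ℝ (Fin d) → EuclideanSpace ℝ (Fin d)}
    {L : ℝ≥0} (hX : ∀ s, LipschitzWith L (X s)) {M : ℝ} {ξ : EuclideanSpace ℝ (Fin d)}
    (hM : ∀ s, ‖X s ξ‖ ≤ M)
    (hmeas : ∀ y : ℝ → EuclideanSpace ℝ (Fin d), Continuous y →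
      AEStronglyMeasurable (fun s => X s (y s)) volume) :
    ∃ x, IsSolution X 0 ξ x := by
  -- With `K ≥ 1` the factor `K e^{2Ks}` is at least `1` and also absorbs the constant bound `M`.
  set K : ℝ := L + 1 with hKdef
  have hK1 : 1 ≤ K := by simp [hKdef]
  have hK : 0 < K := by linarith
  have hM0 : 0 ≤ M := (norm_nonneg _).trans (hM 0)
  -- The unknown is `y(t) = e^{-2Kt} (x(t) - ξ)` for `t ≥ 0`; bounded `y` allow exponential growth
  -- of `x`. Truncating time at `0` makes everything defined on the whole line.
  let G : (ℝ →ᵇ EuclideanSpace ℝ (Fin d)) → ℝ → EuclideanSpace ℝ (Fin d) :=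
    fun y s => X s (ξ + Real.exp (2 * K * max s 0) • y s)
  have hGdiff : ∀ y y' s, ‖G y s - G y' s‖ ≤ dist y y' * (K * Real.exp (2 * K * max s 0)) := by
    intro y y' s
    have h1 := (hX s).dist_le_mul (ξ + Real.exp (2 * K * max s 0) • y s)
      (ξ + Real.exp (2 * K * max s 0) • y' s)
    rw [dist_eq_norm, dist_eq_norm, add_sub_add_left_eq_sub, ← smul_sub, norm_smul,
      Real.norm_of_nonneg (Real.exp_pos _).le, ← dist_eq_norm (y s)] at h1
    calc _ ≤ _ := h1
      _ ≤ K * (Real.exp (2 * K * max s 0) * dist y y') := by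
        gcongr
        · simp [hKdef]
        · exact BoundedContinuousFunction.dist_coe_le_dist s
      _ = _ := by ring
  have hGb : ∀ y s, ‖G y s‖ ≤ (M + ‖y‖) * (K * Real.exp (2 * K * max s 0)) := by
    intro y s
    have h1 := hGdiff y 0 s
    have h2 : G 0 s = X s ξ := by simp [G]
    rw [dist_zero_right, h2] at h1
    have h3 : ‖G y s‖ ≤ ‖G y s - X s ξ‖ + ‖X s ξ‖ := norm_le_norm_sub_add _ _
    have h4 : 1 ≤ K * Real.exp (2 * K * max s 0) :=
      one_le_mul_of_one_le_of_one_le hK1 (Real.one_le_exp (by positivity))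
    have h5 := hM s
    nlinarith
  have hGi : ∀ y a b, IntervalIntegrable (G y) volume a b := by
    intro y a b
    have hc : Continuous fun s => (M + ‖y‖) * (K * Real.exp (2 * K * max s 0)) := by fun_prop
    refine (hc.intervalIntegrable a b).mono_fun (hmeas _ (by fun_prop)).restrict ?_
    refine .of_forall fun s => ?_
    beta_reduce
    rw [Real.norm_of_nonneg (by positivity)]
    exact hGb y s
  have hint : ∀ (h h' : ℝ → EuclideanSpace ℝ (Fin d)) (t : ℝ), (∀ s, 0 ≤ s → h s = h' s) →
      ∫ s in (0 : ℝ)..max t 0, h s = ∫ s in (0 : ℝ)..max t 0, h' s := by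
    intro h h' t hh
    refine intervalIntegral.integral_congr fun s hs => hh s ?_
    rw [uIcc_of_le (le_max_right t 0)] at hs
    exact hs.1
  have key : ∀ (h : ℝ → EuclideanSpace ℝ (Fin d)) (A t : ℝ), 0 ≤ A →
      (∀ s, ‖h s‖ ≤ A * (K * Real.exp (2 * K * max s 0))) →
      Real.exp (-(2 * K * max t 0)) * ‖∫ s in (0 : ℝ)..max t 0, h s‖ ≤ A / 2 := by
    intro h A t hA hh
    rw [hint h (fun s => if 0 ≤ s then h s else 0) t (fun s hs => (if_pos hs).symm)]
    refine exp_neg_mul_norm_integral_le hA (le_max_right _ _) fun s => ?_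
    by_cases hs : 0 ≤ s
    · simpa [hs] using hh s
    · simp only [hs, if_false, norm_zero]
      positivity
  let Φ : (ℝ →ᵇ EuclideanSpace ℝ (Fin d)) → (ℝ →ᵇ EuclideanSpace ℝ (Fin d)) := fun y =>
    BoundedContinuousFunction.ofNormedAddCommGroup
      (fun t => Real.exp (-(2 * K * max t 0)) • ∫ s in (0 : ℝ)..max t 0, G y s)
      (by
        have h1 := intervalIntegral.continuous_primitive (hGi y) 0
        have h2 : Continuous fun t : ℝ => max t 0 := by fun_prop
        have h3 := h1.comp h2
        have h4 : Continuous fun t : ℝ => Real.exp (-(2 * K * max t 0)) := by fun_prop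
        exact h4.smul h3)
      ((M + ‖y‖) / 2)
      (fun t => by
        rw [norm_smul, Real.norm_of_nonneg (Real.exp_pos _).le]
        exact key _ _ t (by positivity) (hGb y))
  have hΦ : ContractingWith (1 / 2) Φ := by
    refine ⟨by rw [← NNReal.coe_lt_coe]; norm_num, LipschitzWith.of_dist_le_mul fun y y' => ?_⟩
    refine (BoundedContinuousFunction.dist_le (by positivity)).2 fun t => ?_
    change dist (Real.exp (-(2 * K * max t 0)) • ∫ s in (0 : ℝ)..max t 0, G y s)
      (Real.exp (-(2 * K * max t 0)) • ∫ s in (0 : ℝ)..max t 0, G y' s) ≤ _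
    rw [dist_eq_norm, ← smul_sub, ← intervalIntegral.integral_sub (hGi y _ _) (hGi y' _ _),
      norm_smul, Real.norm_of_nonneg (Real.exp_pos _).le]
    refine (key _ _ t dist_nonneg (hGdiff y y')).trans (le_of_eq ?_)
    push_cast
    ring
  set y := ContractingWith.fixedPoint Φ hΦ with hy
  have hfix : Φ y = y := hΦ.fixedPoint_isFixedPt
  have hyt : ∀ t, Real.exp (-(2 * K * max t 0)) • ∫ s in (0 : ℝ)..max t 0, G y s = y t :=
    fun t => congrArg (fun z : ℝ →ᵇ EuclideanSpace ℝ (Fin d) => z t) hfix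
  refine ⟨fun t => ξ + Real.exp (2 * K * max t 0) • y t,
    Continuous.continuousOn (by fun_prop), fun t ht => ⟨hGi y 0 t, ?_⟩⟩
  have h1 := hyt t
  rw [max_eq_left ht] at h1
  change ξ + Real.exp (2 * K * max t 0) • y t = ξ + ∫ s in (0 : ℝ)..t, G y s
  rw [max_eq_left ht, ← h1, smul_smul, ← Real.exp_add, add_neg_cancel, Real.exp_zero, one_smul]

/-! ### The scheduling signal of one channel -/

theorem measurable_switchIndex (m : ℕ) {τ : ℝ → ℝ} (hτ : Measurable τ) :
    Measurable (switchIndex m τ) := by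
  have hc : Measurable (fun n : ℤ => (n : ℝ)) := measurable_of_countable _
  have h1 : Measurable fun t => t / (m * τ t) := by fun_prop
  have h2 : Measurable fun t => (⌊t / (m * τ t)⌋ : ℝ) := hc.comp h1.floor
  have h3 : Measurable fun t => (t - m * τ t * ⌊t / (m * τ t)⌋) / τ t := by fun_prop
  exact (measurable_const (a := (1 : ℤ))).add h3.floor

/-- The deviation of the scheduling signal of the `k`-th channel from its mean, for a constant
switching time `p`. -/
noncomputable def channelWeight (m : ℕ) (p : ℝ) (k : Fin m) (t : ℝ) : ℝ :=
  (if switchIndex m (fun _ => p) t = (k : ℤ) + 1 then (m : ℝ) else 0) - 1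

theorem measurable_channelWeight (m : ℕ) (p : ℝ) (k : Fin m) : Measurable (channelWeight m p k) :=
  (Measurable.ite (measurable_switchIndex m measurable_const (measurableSet_singleton _))
    measurable_const measurable_const).sub measurable_const

theorem abs_channelWeight_le {m : ℕ} (p : ℝ) (k : Fin m) (t : ℝ) : |channelWeight m p k t| ≤ m := by
  have hm : (1 : ℝ) ≤ m := by exact_mod_cast k.pos
  unfold channelWeight
  split_ifs <;> rw [abs_le] <;> constructor <;> linarith

theorem channelWeight_periodic {m : ℕ} {p : ℝ} (hp : 0 < p) (k : Fin m) :
    Function.Periodic (channelWeight m p k) (m * p) := by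
  have hm : (0 : ℝ) < m := by exact_mod_cast k.pos
  intro t
  have h1 : (t + m * p) / (m * p) = t / (m * p) + 1 := by field_simp
  have h2 : switchIndex m (fun _ => p) (t + m * p) = switchIndex m (fun _ => p) t := by
    simp only [switchIndex, h1, Int.floor_add_one]
    congr 3
    push_cast
    ring
  simp only [channelWeight, h2]

/-- On `[0, m p)` the inner floor vanishes and channel `k` is active exactly on `[k p, (k + 1) p)`,
so a gain `m` over length `p` balances the mean `1` over length `m p`. -/
theorem integral_channelWeight {m : ℕ} {p : ℝ} (hp : 0 < p) (k : Fin m) :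
    ∫ t in (0 : ℝ)..m * p, channelWeight m p k t = 0 := by
  have hm : (0 : ℝ) < m := by exact_mod_cast k.pos
  have hk : ((k : ℕ) : ℝ) + 1 ≤ m := by exact_mod_cast k.isLt
  have hmp : 0 < m * p := by positivity
  rw [intervalIntegral.integral_of_le hmp.le, ← integral_Ico_eq_integral_Ioc]
  have h1 : EqOn (channelWeight m p k)
      (fun t => (Ico (k * p) ((k + 1) * p)).indicator (fun _ => (m : ℝ)) t - 1)
      (Ico 0 (m * p)) := by
    intro t ht
    have h2 : ⌊t / (m * p)⌋ = 0 := by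
      rw [Int.floor_eq_zero_iff]
      exact ⟨div_nonneg ht.1 hmp.le, (div_lt_one hmp).2 ht.2⟩
    have h3 : switchIndex m (fun _ => p) t = (k : ℤ) + 1 ↔ t ∈ Ico ((k : ℝ) * p) ((k + 1) * p) := by
      simp only [switchIndex, h2, Int.cast_zero, mul_zero, sub_zero]
      rw [add_comm 1, add_left_inj, Int.floor_eq_iff, le_div_iff₀ hp, div_lt_iff₀ hp, mem_Ico]
      simp
    simp only [channelWeight, h3, indicator]
  rw [setIntegral_congr_fun measurableSet_Ico h1, integral_sub, setIntegral_indicator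
    measurableSet_Ico, inter_eq_right.2]
  · simp only [setIntegral_const, Real.volume_real_Ico, smul_eq_mul, sub_zero, mul_one]
    rw [max_eq_left, max_eq_left hmp.le]
    · ring
    · ring_nf; exact hp.le
  · exact Ico_subset_Ico (by positivity) (by gcongr)
  · exact (integrable_const _).indicator measurableSet_Ico
  · exact integrable_const _

/-! ### Lipschitz extensions and estimates for the vector fields -/

theorem exists_lipschitz_extension {d : ℕ}
    {h : EuclideanSpace ℝ (Fin d) → EuclideanSpace ℝ (Fin d)} (hh : LocallyLipschitz h)
    {K : Set (EuclideanSpace ℝ (Fin d))} (hK : IsCompact K) :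
    ∃ (L : ℝ≥0) (h' : EuclideanSpace ℝ (Fin d) → EuclideanSpace ℝ (Fin d)),
      LipschitzWith L h' ∧ EqOn h h' K := by
  obtain ⟨L, hL⟩ := (hh.locallyLipschitzOn (s := K)).exists_lipschitzOnWith_of_compact hK
  obtain ⟨h', h1, h2⟩ := hL.extend_finite_dimension
  exact ⟨_, h', h1, h2⟩

theorem exists_common_lipschitz_extension {d m : ℕ}
    {f : EuclideanSpace ℝ (Fin d) → EuclideanSpace ℝ (Fin d)}
    {h : Fin m → EuclideanSpace ℝ (Fin d) → EuclideanSpace ℝ (Fin d)}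
    (hf : LocallyLipschitz f) (hh : ∀ k, LocallyLipschitz (h k))
    {K : Set (EuclideanSpace ℝ (Fin d))} (hK : IsCompact K) :
    ∃ (L : ℝ≥0) (f' : EuclideanSpace ℝ (Fin d) → EuclideanSpace ℝ (Fin d))
      (h' : Fin m → EuclideanSpace ℝ (Fin d) → EuclideanSpace ℝ (Fin d)),
      LipschitzWith L f' ∧ (∀ k, LipschitzWith L (h' k)) ∧ EqOn f f' K ∧
        ∀ k, EqOn (h k) (h' k) K := by
  obtain ⟨L₀, f', hf', hff'⟩ := exists_lipschitz_extension hf hK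
  choose L h' hh' hhh' using fun k => exists_lipschitz_extension (hh k) hK
  refine ⟨L₀ + ∑ k, L k, f', h', hf'.weaken le_self_add, fun k => (hh' k).weaken ?_, hff', hhh'⟩
  exact (Finset.single_le_sum (fun _ _ => zero_le) (Finset.mem_univ k)).trans le_add_self

section
variable {d m : ℕ} {f : EuclideanSpace ℝ (Fin d) → EuclideanSpace ℝ (Fin d)}
  {g : Fin m → EuclideanSpace ℝ (Fin d) → EuclideanSpace ℝ (Fin d)}
  {u : Fin m → EuclideanSpace ℝ (Fin d) → ℝ}

theorem norm_scheduled_sub_le {τ : ℝ → ℝ} {t₀ t L : ℝ} {x y : EuclideanSpace ℝ (Fin d)}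
    (hf : ‖f x - f y‖ ≤ L * ‖x - y‖)
    (hh : ∀ k, ‖u k x • g k x - u k y • g k y‖ ≤ L * ‖x - y‖) :
    ‖scheduled f g u τ t₀ t x - scheduled f g u τ t₀ t y‖ ≤ (L + m * (m * L)) * ‖x - y‖ := by
  have hL : 0 ≤ L * ‖x - y‖ := (norm_nonneg _).trans hf
  unfold scheduled
  rw [add_sub_add_comm, ← smul_sub, ← Finset.sum_sub_distrib]
  refine (norm_add_le _ _).trans ?_
  rw [norm_smul, Real.norm_natCast]
  have h1 : ‖∑ k : Fin m, ((if switchIndex m τ (t - t₀) = (k : ℤ) + 1 then u k x • g k x else 0) -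
      (if switchIndex m τ (t - t₀) = (k : ℤ) + 1 then u k y • g k y else 0))‖ ≤
      ∑ _k : Fin m, L * ‖x - y‖ := by
    refine norm_sum_le_of_le _ fun k _ => ?_
    split_ifs
    · exact hh k
    · simpa using hL
  rw [Finset.sum_const, Finset.card_univ, Fintype.card_fin, nsmul_eq_mul] at h1
  calc _ ≤ L * ‖x - y‖ + m * (m * (L * ‖x - y‖)) := by gcongr
    _ = _ := by ring

theorem norm_closedLoop_sub_le {L : ℝ} {x y : EuclideanSpace ℝ (Fin d)}
    (hf : ‖f x - f y‖ ≤ L * ‖x - y‖)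
    (hh : ∀ k, ‖u k x • g k x - u k y • g k y‖ ≤ L * ‖x - y‖) :
    ‖closedLoop f g u x - closedLoop f g u y‖ ≤ (L + m * L) * ‖x - y‖ := by
  unfold closedLoop
  rw [add_sub_add_comm, ← Finset.sum_sub_distrib]
  have h1 : ‖∑ k : Fin m, (u k x • g k x - u k y • g k y)‖ ≤ ∑ _k : Fin m, L * ‖x - y‖ :=
    norm_sum_le_of_le _ fun k _ => hh k
  rw [Finset.sum_const, Finset.card_univ, Fintype.card_fin, nsmul_eq_mul] at h1
  calc _ ≤ L * ‖x - y‖ + m * (L * ‖x - y‖) := (norm_add_le _ _).trans (add_le_add hf h1)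
    _ = _ := by ring

theorem scheduled_eq_closedLoop_add (p r : ℝ) (x : EuclideanSpace ℝ (Fin d)) :
    scheduled f g u (fun _ => p) 0 r x =
      closedLoop f g u x + ∑ k, channelWeight m p k r • (u k x • g k x) := by
  unfold scheduled closedLoop
  rw [add_assoc, ← Finset.sum_add_distrib, Finset.smul_sum]
  congr 1
  refine Finset.sum_congr rfl fun k _ => ?_
  simp only [channelWeight, sub_zero, sub_smul, one_smul]
  split_ifs <;> simp

/-- The switching index at a given instant depends on `τ` only through its value there, so within a
window `τ` can be replaced by a constant. -/
theorem scheduled_congr_switching {τ τ' : ℝ → ℝ} {t₀ t : ℝ} (h : τ (t - t₀) = τ' (t - t₀)) :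
    scheduled f g u τ t₀ t = scheduled f g u τ' t₀ t := by
  funext x
  have h1 : switchIndex m τ (t - t₀) = switchIndex m τ' (t - t₀) := by
    simp only [switchIndex, h]
  simp only [scheduled, h1]

end

/-! ### Comparison and uniqueness of solutions -/

/-- Continuous dependence of Carathéodory solutions on the initial state. -/
theorem IsSolution.norm_sub_le {d : ℕ}
    {X : ℝ → EuclideanSpace ℝ (Fin d) → EuclideanSpace ℝ (Fin d)} {t₀ t₁ K : ℝ}
    {ξ ξ' : EuclideanSpace ℝ (Fin d)} {x x' : ℝ → EuclideanSpace ℝ (Fin d)}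
    (hx : IsSolution X t₀ ξ x) (hx' : IsSolution X t₀ ξ' x') (hK : 0 ≤ K) (ht : t₀ ≤ t₁)
    (hX : ∀ t ∈ Icc t₀ t₁, ‖X t (x t) - X t (x' t)‖ ≤ K * ‖x t - x' t‖) :
    ‖x t₁ - x' t₁‖ ≤ ‖ξ - ξ'‖ * Real.exp (K * (t₁ - t₀)) := by
  have hc : ContinuousOn (fun t => ‖x t - x' t‖) (Icc t₀ t₁) :=
    ((hx.1.mono Icc_subset_Ici_self).sub (hx'.1.mono Icc_subset_Ici_self)).norm
  refine le_mul_exp_of_le_add_integral hc (fun t _ => norm_nonneg _) hK (fun t ht => ?_)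
    (right_mem_Icc.2 ht)
  rw [(hx.2 t ht.1).2, (hx'.2 t ht.1).2, add_sub_add_comm,
    ← intervalIntegral.integral_sub (hx.2 t ht.1).1 (hx'.2 t ht.1).1,
    ← intervalIntegral.integral_const_mul]
  refine (norm_add_le _ _).trans (add_le_add le_rfl ?_)
  have hsub : Icc t₀ t ⊆ Icc t₀ t₁ := Icc_subset_Icc_right ht.2
  refine intervalIntegral.norm_integral_le_of_norm_le ht.1
    (.of_forall fun s hs => hX s (hsub (Ioc_subset_Icc_self hs))) ?_
  refine ContinuousOn.intervalIntegrable ?_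
  rw [uIcc_of_le ht.1]
  exact continuousOn_const.mul (hc.mono hsub)

/-- Two given solutions sweep out a compact set over `[t₀, t]`, where the data are Lipschitz;
continuous dependence with equal initial states then forces equality. -/
theorem IsSolution.eqOn_of_locallyLipschitz {d m : ℕ}
    {f : EuclideanSpace ℝ (Fin d) → EuclideanSpace ℝ (Fin d)}
    {g : Fin m → EuclideanSpace ℝ (Fin d) → EuclideanSpace ℝ (Fin d)}
    {u : Fin m → EuclideanSpace ℝ (Fin d) → ℝ} {τ : ℝ → ℝ} {t₀ : ℝ}
    {ξ : EuclideanSpace ℝ (Fin d)} {z z' : ℝ → EuclideanSpace ℝ (Fin d)}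
    (hf : LocallyLipschitz f) (hh : ∀ k, LocallyLipschitz fun x => u k x • g k x)
    (hz : IsSolution (scheduled f g u τ t₀) t₀ ξ z)
    (hz' : IsSolution (scheduled f g u τ t₀) t₀ ξ z') : EqOn z z' (Ici t₀) := by
  intro t ht
  have hK : IsCompact (z '' Icc t₀ t ∪ z' '' Icc t₀ t) :=
    (isCompact_Icc.image_of_continuousOn (hz.1.mono Icc_subset_Ici_self)).union
      (isCompact_Icc.image_of_continuousOn (hz'.1.mono Icc_subset_Ici_self))
  obtain ⟨L, f', h', hf', hh', hff', hhh'⟩ := exists_common_lipschitz_extension hf hh hK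
  have h1 := hz.norm_sub_le hz' (K := L + m * (m * L)) (by positivity) ht fun s hs => by
    have hs1 : z s ∈ z '' Icc t₀ t ∪ z' '' Icc t₀ t := .inl (mem_image_of_mem _ hs)
    have hs2 : z' s ∈ z '' Icc t₀ t ∪ z' '' Icc t₀ t := .inr (mem_image_of_mem _ hs)
    refine norm_scheduled_sub_le ?_ fun k => ?_
    · rw [hff' hs1, hff' hs2]
      exact hf'.norm_sub_le _ _
    · have e1 := hhh' k hs1
      have e2 := hhh' k hs2
      dsimp only at e1 e2
      rw [e1, e2]
      exact (hh' k).norm_sub_le _ _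
  rw [sub_self, norm_zero, zero_mul] at h1
  exact sub_eq_zero.1 (norm_le_zero_iff.1 h1)

/-- Averaging estimate on a time window with constant switching time. -/
theorem norm_scheduled_solution_sub_le {d m : ℕ}
    {f : EuclideanSpace ℝ (Fin d) → EuclideanSpace ℝ (Fin d)}
    {g : Fin m → EuclideanSpace ℝ (Fin d) → EuclideanSpace ℝ (Fin d)}
    {u : Fin m → EuclideanSpace ℝ (Fin d) → ℝ} {τ : ℝ → ℝ} {L : ℝ≥0} {M p a b : ℝ}
    {η : EuclideanSpace ℝ (Fin d)} {x y : ℝ → EuclideanSpace ℝ (Fin d)} (hp : 0 < p)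
    (hm : 0 < m) (hf : LipschitzWith L f) (hh : ∀ k, LipschitzWith L fun x => u k x • g k x)
    (hτ : ∀ r ∈ Ico a b, τ r = p) (hyc : ContinuousOn y (Icc a b))
    (hyi : IntervalIntegrable (fun r => scheduled f g u τ 0 r (y r)) volume a b)
    (hy : ∀ q ∈ Icc a b, y q = η + ∫ r in a..q, scheduled f g u τ 0 r (y r))
    (hxc : ContinuousOn x (Icc a b))
    (hx : ∀ q ∈ Icc a b, x q = η + ∫ r in a..q, closedLoop f g u (x r))
    (hM : ∀ r ∈ Icc a b, ‖closedLoop f g u (x r)‖ ≤ M)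
    (hMk : ∀ r ∈ Icc a b, ∀ k, ‖u k (x r) • g k (x r)‖ ≤ M) {q : ℝ} (hq : q ∈ Icc a b) :
    ‖y q - x q‖ ≤
      m * (m * M * (m * p) + m * (L * M) * (m * p) * (b - a)) *
        Real.exp ((L + m * (m * L)) * (q - a)) := by
  have hab : a ≤ b := hq.1.trans hq.2
  have hM0 : 0 ≤ M := (norm_nonneg _).trans (hM a ⟨le_rfl, hab⟩)
  have hmp : (0 : ℝ) < m * p := by positivity
  have hFc : Continuous (closedLoop f g u) :=
    hf.continuous.add (continuous_finsetSum _ fun k _ => (hh k).continuous)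
  have hFi : ∀ s ∈ Icc a b, ∀ t ∈ Icc a b,
      IntervalIntegrable (fun r => closedLoop f g u (x r)) volume s t := fun s hs t ht =>
    ((hFc.comp_continuousOn hxc).mono (uIcc_subset_Icc hs ht)).intervalIntegrable
  have hhc : ∀ k, ContinuousOn (fun r => u k (x r) • g k (x r)) (Icc a b) := fun k =>
    (hh k).continuous.comp_continuousOn hxc
  have hxL : ∀ s ∈ Icc a b, ∀ t ∈ Icc a b, ‖x s - x t‖ ≤ M * |s - t| := by
    intro s hs t ht
    have ha : a ∈ Icc a b := ⟨le_rfl, hab⟩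
    rw [hx s hs, hx t ht, add_sub_add_left_eq_sub,
      intervalIntegral.integral_interval_sub_left (hFi a ha s hs) (hFi a ha t ht)]
    refine intervalIntegral.norm_integral_le_of_norm_le_const fun r hr => hM r ?_
    exact uIcc_subset_Icc ht hs (uIoc_subset_uIcc hr)
  have hBi : ∀ k, ∀ t ∈ Icc a b, IntervalIntegrable
      (fun r => channelWeight m p k r • (u k (x r) • g k (x r))) volume a t := by
    intro k t ht
    have hw : IntervalIntegrable (channelWeight m p k) volume a t := by
      refine (intervalIntegrable_const (c := (m : ℝ))).mono_fun
        (measurable_channelWeight m p k).aestronglyMeasurable (.of_forall fun s => ?_)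
      simpa using abs_channelWeight_le p k s
    exact hw.smul_continuousOn
      ((hhc k).mono (uIcc_subset_Icc ⟨le_rfl, hab⟩ ht))
  have hB : ∀ t ∈ Icc a b,
      ‖∫ r in a..t, ∑ k, channelWeight m p k r • (u k (x r) • g k (x r))‖ ≤
        m * (m * M * (m * p) + m * (L * M) * (m * p) * (b - a)) := by
    intro t ht
    rw [intervalIntegral.integral_finsetSum fun k _ => hBi k t ht]
    have hsub : Icc a t ⊆ Icc a b := Icc_subset_Icc_right ht.2
    have h1 : ∀ k ∈ Finset.univ,
        ‖∫ r in a..t, channelWeight m p k r • (u k (x r) • g k (x r))‖ ≤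
          m * M * (m * p) + m * (L * M) * (m * p) * (b - a) := fun k _ => by
      have h2 := norm_integral_periodic_smul_le (Λ := L * M) hmp (channelWeight_periodic hp k)
        (measurable_channelWeight m p k) (abs_channelWeight_le p k) (integral_channelWeight hp k)
        ht.1 (fun r hr => hMk r (hsub hr) k) (fun r hr s hs => by
          have h3 := (hh k).norm_sub_le (x r) (x s)
          have h4 := hxL r (hsub hr) s (hsub hs)
          calc _ ≤ _ := h3
            _ ≤ L * (M * |r - s|) := by gcongr
            _ = _ := by ring) (by positivity)
      refine h2.trans ?_
      gcongr
      exact ht.2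
    refine (norm_sum_le_of_le _ h1).trans ?_
    rw [Finset.sum_const, Finset.card_univ, Fintype.card_fin, nsmul_eq_mul]
  have hc : ContinuousOn (fun t => ‖y t - x t‖) (Icc a b) := (hyc.sub hxc).norm
  refine le_mul_exp_of_le_add_integral hc (fun t _ => norm_nonneg _) (by positivity)
    (fun t ht => ?_) hq
  have hsub : Icc a t ⊆ Icc a b := Icc_subset_Icc_right ht.2
  have hyit : IntervalIntegrable (fun r => scheduled f g u τ 0 r (y r)) volume a t :=
    hyi.mono_set (by rw [uIcc_of_le ht.1, uIcc_of_le hab]; exact hsub)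
  have hFit := hFi a ⟨le_rfl, hab⟩ t ht
  have hBit : IntervalIntegrable
      (fun r => ∑ k, channelWeight m p k r • (u k (x r) • g k (x r))) volume a t := by
    simpa only [Finset.sum_fn] using! IntervalIntegrable.sum _ fun k _ => hBi k t ht
  -- The oscillating term is evaluated along `x`, whose speed is bounded independently of the
  -- switching. The rest is the scheduled field at `y` minus the same field at `x`, which Grönwall
  -- handles.
  have hsplit : y t - x t =
      (∫ r in a..t, (scheduled f g u τ 0 r (y r) - closedLoop f g u (x r) -
        ∑ k, channelWeight m p k r • (u k (x r) • g k (x r)))) +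
      ∫ r in a..t, ∑ k, channelWeight m p k r • (u k (x r) • g k (x r)) := by
    rw [intervalIntegral.integral_sub (hyit.sub hFit) hBit, sub_add_cancel,
      intervalIntegral.integral_sub hyit hFit, hy t ht, hx t ht, add_sub_add_left_eq_sub]
  rw [hsplit, add_comm]
  refine (norm_add_le _ _).trans (add_le_add (hB t ht) ?_)
  rw [← intervalIntegral.integral_const_mul]
  refine intervalIntegral.norm_integral_le_of_norm_le ht.1 ?_ ?_
  · have hne : ∀ᵐ r : ℝ, r ≠ t := by simp [ae_iff, measure_singleton]
    filter_upwards [hne] with r hr hr'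
    have h1 : r ∈ Ico a b := ⟨hr'.1.le, (lt_of_le_of_ne hr'.2 hr).trans_le ht.2⟩
    have h2 : scheduled f g u τ 0 r = scheduled f g u (fun _ => p) 0 r :=
      scheduled_congr_switching (by simpa using hτ r h1)
    rw [h2, sub_sub, ← scheduled_eq_closedLoop_add]
    exact norm_scheduled_sub_le (hf.norm_sub_le _ _) fun k => (hh k).norm_sub_le _ _
  · refine ContinuousOn.intervalIntegrable ?_
    rw [uIcc_of_le ht.1]
    exact continuousOn_const.mul (hc.mono hsub)

/-! ### Restriction and translation of solutions -/

theorem IsSolution.eq_add_integral {d : ℕ}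
    {X : ℝ → EuclideanSpace ℝ (Fin d) → EuclideanSpace ℝ (Fin d)} {t₀ a q : ℝ}
    {ξ : EuclideanSpace ℝ (Fin d)} {x : ℝ → EuclideanSpace ℝ (Fin d)}
    (hx : IsSolution X t₀ ξ x) (ha : t₀ ≤ a) (hq : a ≤ q) :
    IntervalIntegrable (fun s => X s (x s)) volume a q ∧
      x q = x a + ∫ s in a..q, X s (x s) := by
  have h1 := hx.2 a ha
  have h2 := hx.2 q (ha.trans hq)
  refine ⟨h2.1.mono_set ?_, ?_⟩
  · rw [uIcc_of_le hq, uIcc_of_le (ha.trans hq)]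
    exact Icc_subset_Icc_left ha
  · rw [h2.2, h1.2, ← intervalIntegral.integral_interval_sub_left h2.1 h1.1, add_assoc,
      add_sub_cancel]

theorem IsSolution.comp_add {d : ℕ}
    {X : ℝ → EuclideanSpace ℝ (Fin d) → EuclideanSpace ℝ (Fin d)} {t₀ s : ℝ}
    {ξ : EuclideanSpace ℝ (Fin d)} {x : ℝ → EuclideanSpace ℝ (Fin d)}
    (hx : IsSolution X t₀ ξ x) {t₁ : ℝ} (hs : t₀ ≤ t₁ + s) :
    IsSolution (fun t => X (t + s)) t₁ (x (t₁ + s)) (fun t => x (t + s)) := by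
  refine ⟨hx.1.comp (by fun_prop) fun t (ht : t₁ ≤ t) => ?_, fun t ht => ?_⟩
  · rw [mem_Ici]
    linarith
  · have h1 := hx.eq_add_integral hs (add_le_add_left ht s)
    refine ⟨?_, ?_⟩
    · have h2 := h1.1.comp_add_right s
      simpa using! h2
    · rw [intervalIntegral.integral_comp_add_right (fun r => X r (x r)) s]
      exact h1.2

theorem IsSolution.congr {d : ℕ}
    {X Y : ℝ → EuclideanSpace ℝ (Fin d) → EuclideanSpace ℝ (Fin d)} {t₀ : ℝ}
    {ξ : EuclideanSpace ℝ (Fin d)} {x : ℝ → EuclideanSpace ℝ (Fin d)}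
    (hx : IsSolution X t₀ ξ x) (h : ∀ t, t₀ ≤ t → X t (x t) = Y t (x t)) :
    IsSolution Y t₀ ξ x := by
  refine ⟨hx.1, fun t ht => ⟨(hx.2 t ht).1.congr fun s hs => ?_, ?_⟩⟩
  · rw [uIoc_of_le ht] at hs
    exact h s hs.1.le
  · rw [(hx.2 t ht).2]
    congr 1
    refine intervalIntegral.integral_congr fun s hs => ?_
    rw [uIcc_of_le ht] at hs
    exact h s hs.1

/-! ### The basin and the sublevel sets of the Lyapunov function -/

section
variable {d : ℕ} {F : EuclideanSpace ℝ (Fin d) → EuclideanSpace ℝ (Fin d)}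
  {V : EuclideanSpace ℝ (Fin d) → ℝ}

theorem isSolution_zero (hF : F 0 = 0) : IsSolution (fun _ => F) 0 0 (fun _ => 0) := by
  refine ⟨continuousOn_const, fun t _ => ?_⟩
  simp [hF]

theorem zero_mem_basin (hF : F 0 = 0) : (0 : EuclideanSpace ℝ (Fin d)) ∈ basin F :=
  ⟨_, isSolution_zero hF, tendsto_const_nhds⟩

namespace IsLyapunovFunction

/-- A basin point belongs to all of its neighbourhoods within the basin, so `V` tending to `+∞`
there would make `V p` exceed itself. -/
theorem notMem_basin (hV : IsLyapunovFunction F V) {p : EuclideanSpace ℝ (Fin d)}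
    (hp : p ∈ frontier (basin F)) : p ∉ basin F := fun h => by
  obtain ⟨n, hn⟩ := exists_gt (V p)
  exact (mem_of_mem_nhdsWithin h
    ((hV.tendsto_frontier p hp).eventually (eventually_ge_atTop n))).not_gt hn

theorem isOpen_basin (hV : IsLyapunovFunction F V) : IsOpen (basin F) := by
  rw [← interior_eq_iff_isOpen]
  refine interior_subset.antisymm fun x hx => ?_
  by_contra h
  exact hV.notMem_basin ⟨subset_closure hx, h⟩ hx

/-- Growth at infinity gives boundedness. A limit point is either in the basin, where continuity
applies, or on its frontier, where blow-up excludes it. -/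
theorem isCompact_sublevel (hV : IsLyapunovFunction F V) (c : ℝ) :
    IsCompact {x | x ∈ basin F ∧ V x ≤ c} := by
  have hbdd : Bornology.IsBounded {x | x ∈ basin F ∧ V x ≤ c} := by
    have h1 := hV.tendsto_infinity.eventually (eventually_gt_atTop c)
    rw [eventually_inf_principal, ← Metric.cobounded_eq_cocompact] at h1
    rw [← Bornology.isCobounded_compl_iff]
    refine mem_of_superset h1 fun x hx hxc => ?_
    exact (hx hxc.1).not_ge hxc.2
  refine Metric.isCompact_of_isClosed_isBounded (isClosed_of_closure_subset fun p hp => ?_) hbdd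
  have hsub : {x | x ∈ basin F ∧ V x ≤ c} ⊆ basin F := fun x hx => hx.1
  have hcl := mem_closure_iff_nhdsWithin_neBot.1 hp
  have hev : ∀ᶠ x in 𝓝[{x | x ∈ basin F ∧ V x ≤ c}] p, V x ≤ c :=
    eventually_mem_nhdsWithin.mono fun x hx => hx.2
  by_cases h : p ∈ basin F
  · exact ⟨h, le_of_tendsto ((hV.contDiffOn.continuousOn p h).mono hsub) hev⟩
  · have hfr : p ∈ frontier (basin F) :=
      ⟨closure_mono hsub hp, fun hi => h (interior_subset hi)⟩
    have h1 := ((hV.tendsto_frontier p hfr).mono_left (nhdsWithin_mono p hsub)).eventually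
      (eventually_gt_atTop c)
    obtain ⟨x, hx1, hx2⟩ := (h1.and hev).exists
    exact absurd hx2 hx1.not_ge

/-- From every point of the basin there is a solution that stays in its sublevel set. -/
theorem exists_isSolution (hV : IsLyapunovFunction F V) (hF : F 0 = 0)
    {ξ : EuclideanSpace ℝ (Fin d)} (hξ : ξ ∈ basin F) :
    ∃ x, IsSolution (fun _ => F) 0 ξ x ∧ (∀ t, 0 ≤ t → x t ∈ basin F ∧ V (x t) ≤ V ξ) ∧
      (ξ ≠ 0 → ∀ t, 0 < t → V (x t) < V ξ) ∧ (ξ = 0 → ∀ t, x t = 0) := by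
  by_cases h0 : ξ = 0
  · subst h0
    exact ⟨fun _ => 0, isSolution_zero hF, fun _ _ => ⟨hξ, le_rfl⟩, fun h => absurd rfl h,
      fun _ _ => rfl⟩
  · obtain ⟨x, hx, hlim⟩ := hξ
    have hx0 : x 0 = ξ := by simpa using (hx.2 0 le_rfl).2
    have hlt : ∀ t, 0 < t → V (x t) < V ξ := fun t ht => by
      have h1 := hV.strictAnti ξ ⟨x, hx, hlim⟩ h0 x hx (mem_Ici.2 le_rfl) (mem_Ici.2 ht.le) ht
      simpa [hx0] using h1
    -- The time-translated solution witnesses that `x t` is again in the basin.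
    refine ⟨x, hx, fun t ht => ⟨⟨fun r => x (r + t), ?_, ?_⟩, ?_⟩, fun _ => hlt,
      fun h => absurd h h0⟩
    · simpa using hx.comp_add (t₁ := 0) (s := t) (by simpa using ht)
    · exact hlim.comp (tendsto_atTop_add_const_right _ _ tendsto_id)
    · rcases ht.eq_or_lt with rfl | ht
      · rw [hx0]
      · exact (hlt t ht).le

end IsLyapunovFunction
end

/-! ### Perturbed orbits and an admissible switching time -/

/-- Asymptotically vanishing perturbations of a discrete dynamical system on a compact set
with a strict Lyapunov function converge to the equilibrium. -/
theorem tendsto_zero_of_asymptotic_orbit {E : Type*} [NormedAddCommGroup E] {S : Set E}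
    (hS : IsCompact S) {Φ : E → E} {V : E → ℝ} (hΦ : ContinuousOn Φ S) (hV : ContinuousOn V S)
    (hΦ0 : Φ 0 = 0) (hpos : ∀ x ∈ S, x ≠ 0 → V 0 < V x)
    (hdec : ∀ x ∈ S, x ≠ 0 → V (Φ x) < V x) {z : ℕ → E} (hz : ∀ n, z n ∈ S)
    (hd : Tendsto (fun n => z (n + 1) - Φ (z n)) atTop (𝓝 0)) :
    Tendsto z atTop (𝓝 0) := by
  refine hS.tendsto_nhds_of_unique_mapClusterPt (.of_forall hz) fun p' hp' hcl' => ?_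
  by_contra hne
  have hωcl : IsClosed {p | MapClusterPt p atTop z} := isClosed_setOfPred_clusterPt
  -- Let `p` maximise `V` over the compact set of cluster points. It will be shown that `p = Φ q`
  -- for a cluster point `q`; if `q ≠ 0`, then `V p < V q` contradicts maximality, and if `q = 0`,
  -- then `p = 0` contradicts the nonzero cluster point `p'`.
  obtain ⟨p, ⟨hpS, hp⟩, hmax⟩ := (hS.inter_right hωcl).exists_isMaxOn ⟨p', hp', hcl'⟩
    (hV.mono inter_subset_left)
  have hp1 : MapClusterPt p atTop (fun n => z (n + 1)) := by
    have : map (fun n => z (n + 1)) atTop = map z atTop := by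
      conv_rhs => rw [← map_add_atTop_eq_nat 1, map_map]
      rfl
    rwa [MapClusterPt, this]
  -- Along one ultrafilter `z (n + 1) → p`, while compactness makes `z n` converge too; its limit is
  -- `q`.
  obtain ⟨U, hU, hUp⟩ := mapClusterPt_iff_ultrafilter.1 hp1
  obtain ⟨q, hqS, hUq⟩ := hS.ultrafilter_le_nhds (U.map z)
    (le_principal_iff.2 (Ultrafilter.mem_map.2 (univ_mem' hz)))
  have hUq' : Tendsto z U (𝓝 q) := hUq
  have hq : MapClusterPt q atTop z := mapClusterPt_iff_ultrafilter.2 ⟨U, hU, hUq'⟩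
  have hΦq : Tendsto (fun n => Φ (z n)) U (𝓝 (Φ q)) :=
    (hΦ q hqS).tendsto.comp (tendsto_nhdsWithin_iff.2 ⟨hUq', .of_forall hz⟩)
  have h1 := (hd.mono_left hU).add hΦq
  simp only [sub_add_cancel, zero_add] at h1
  have hpq : p = Φ q := tendsto_nhds_unique hUp h1
  by_cases hq0 : q = 0
  · rw [hq0, hΦ0] at hpq
    have h2 : V p' ≤ V p := hmax ⟨hp', hcl'⟩
    rw [hpq] at h2
    exact (hpos p' hp' hne).not_ge h2
  · have h2 : V q ≤ V p := hmax ⟨hqS, hq⟩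
    rw [hpq] at h2
    exact (hdec q hqS hq0).not_ge h2

theorem isSwitchingTime_harmonic {T c : ℝ} (hT : 0 < T) (hc : 0 < c) :
    IsSwitchingTime T (fun t => c / (1 + ⌊t / T⌋₊)) where
  pos t _ := by positivity
  antitone s _ t _ hst := by
    have : ⌊s / T⌋₊ ≤ ⌊t / T⌋₊ := Nat.floor_mono (by gcongr)
    dsimp only
    gcongr
  piecewise_const n t ht := by
    have h1 : ⌊t / T⌋₊ = n := by
      rw [Nat.floor_eq_iff (div_nonneg ((by positivity : (0 : ℝ) ≤ n * T).trans ht.1) hT.le)]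
      exact ⟨(le_div_iff₀ hT).2 ht.1, (div_lt_iff₀ hT).2 ht.2⟩
    have h2 : ⌊(n * T) / T⌋₊ = n := by rw [mul_div_cancel_right₀ _ hT.ne', Nat.floor_natCast]
    simp only [h1, h2]
  tendsto_zero := by
    have h1 : Tendsto (fun t : ℝ => ⌊t / T⌋₊) atTop atTop :=
      tendsto_nat_floor_atTop.comp (tendsto_id.atTop_div_const hT)
    exact tendsto_const_nhds.div_atTop
      (tendsto_atTop_add_const_left _ _ (tendsto_natCast_atTop_atTop.comp h1))

/-! ### Solutions of the scheduled system and their convergence -/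

/-- Existence of solutions of the scheduled system for globally Lipschitz data. -/
theorem exists_isSolution_scheduled {d m : ℕ}
    {f : EuclideanSpace ℝ (Fin d) → EuclideanSpace ℝ (Fin d)}
    {g : Fin m → EuclideanSpace ℝ (Fin d) → EuclideanSpace ℝ (Fin d)}
    {u : Fin m → EuclideanSpace ℝ (Fin d) → ℝ} {τ : ℝ → ℝ} {L : ℝ≥0} (hf : LipschitzWith L f)
    (hh : ∀ k, LipschitzWith L fun x => u k x • g k x) (hτ : AntitoneOn τ (Ici 0))
    (ξ : EuclideanSpace ℝ (Fin d)) : ∃ y, IsSolution (scheduled f g u τ 0) 0 ξ y := by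
  -- Frozen at negative times, the switching time is antitone on the whole line and hence
  -- measurable.
  set τ' : ℝ → ℝ := fun t => τ (max t 0)
  have hτ' : Measurable τ' := Antitone.measurable fun s t hst =>
    hτ (le_max_right s 0) (le_max_right t 0) (max_le_max_right 0 hst)
  have hLip : ∀ s, LipschitzWith (L + m * (m * L)) (scheduled f g u τ' 0 s) := fun s =>
    LipschitzWith.of_dist_le_mul fun x y => by
      rw [dist_eq_norm, dist_eq_norm]
      exact_mod_cast norm_scheduled_sub_le (hf.norm_sub_le x y) fun k => (hh k).norm_sub_le x y
  obtain ⟨y, hy⟩ := exists_isSolution (ξ := ξ) hLip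
    (M := ‖f ξ‖ + m * ∑ k, ‖u k ξ • g k ξ‖) (fun s => by
      refine (norm_add_le _ _).trans (add_le_add le_rfl ?_)
      rw [norm_smul, Real.norm_natCast]
      gcongr
      refine norm_sum_le_of_le _ fun k _ => ?_
      split_ifs <;> simp) (fun y hy => by
      refine AEStronglyMeasurable.add (hf.continuous.comp hy).aestronglyMeasurable
        (AEStronglyMeasurable.fun_const_smul ?_ _)
      refine Finset.aestronglyMeasurable_fun_sum _ fun k _ => ?_
      refine (StronglyMeasurable.ite ?_ ((hh k).continuous.comp hy).stronglyMeasurable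
        stronglyMeasurable_const).aestronglyMeasurable
      have h1 : Measurable fun s : ℝ => switchIndex m τ' (s - 0) :=
        (measurable_switchIndex m hτ').comp (measurable_id.sub_const 0)
      exact h1 (measurableSet_singleton _))
  refine ⟨y, hy.congr fun t ht => ?_⟩
  rw [scheduled_congr_switching (τ' := τ)]
  simp [τ', ht]

theorem exists_norm_le_of_isCompact {d m : ℕ}
    {F : EuclideanSpace ℝ (Fin d) → EuclideanSpace ℝ (Fin d)}
    {h : Fin m → EuclideanSpace ℝ (Fin d) → EuclideanSpace ℝ (Fin d)} (hF : Continuous F)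
    (hh : ∀ k, Continuous (h k)) {S : Set (EuclideanSpace ℝ (Fin d))} (hS : IsCompact S) :
    ∃ M, 0 ≤ M ∧ ∀ x ∈ S, ‖F x‖ ≤ M ∧ ∀ k, ‖h k x‖ ≤ M := by
  have hc : Continuous fun x => ‖F x‖ + ∑ k, ‖h k x‖ := by fun_prop
  obtain ⟨M, hM⟩ := hS.exists_bound_of_continuousOn hc.continuousOn
  refine ⟨|M|, abs_nonneg M, fun x hx => ?_⟩
  have h1 := (le_abs_self _).trans ((hM x hx).trans (le_abs_self M))
  have h2 : 0 ≤ ∑ k, ‖h k x‖ := Finset.sum_nonneg fun k _ => norm_nonneg _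
  refine ⟨by linarith, fun k => ?_⟩
  have h3 := Finset.single_le_sum (f := fun k => ‖h k x‖) (fun k _ => norm_nonneg _)
    (Finset.mem_univ k)
  linarith [norm_nonneg (F x)]

/-- For a sufficiently fine switching time, the scheduled system started at time `0` in a sublevel
set of the Lyapunov function has a solution that converges to the origin. -/
theorem exists_isSolution_tendsto_zero {d m : ℕ} (hm : 0 < m)
    {f : EuclideanSpace ℝ (Fin d) → EuclideanSpace ℝ (Fin d)}
    {g : Fin m → EuclideanSpace ℝ (Fin d) → EuclideanSpace ℝ (Fin d)}
    {u : Fin m → EuclideanSpace ℝ (Fin d) → ℝ} (hf : LocallyLipschitz f)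
    (hh : ∀ k, LocallyLipschitz fun x => u k x • g k x) (hF : closedLoop f g u 0 = 0)
    {V : EuclideanSpace ℝ (Fin d) → ℝ} (hV : IsLyapunovFunction (closedLoop f g u) V)
    {T θ : ℝ} (hT : 0 < T) (hθ : 0 < θ) :
    ∃ c > 0, ∀ ξ ∈ basin (closedLoop f g u), V ξ ≤ θ → ∀ τ, IsSwitchingTime T τ →
      (∀ t, 0 ≤ t → τ t ≤ c) →
      ∃ y, IsSolution (scheduled f g u τ 0) 0 ξ y ∧ Tendsto y atTop (𝓝 0) := by
  set S := {x | x ∈ basin (closedLoop f g u) ∧ V x ≤ θ} with hSdef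
  have hS : IsCompact S := hV.isCompact_sublevel θ
  have hS0 : (0 : EuclideanSpace ℝ (Fin d)) ∈ S := ⟨zero_mem_basin hF, by rw [hV.zero]; exact hθ.le⟩
  have hex : ∀ ξ, ∃ x, ξ ∈ S → IsSolution (fun _ => closedLoop f g u) 0 ξ x ∧
      (∀ t, 0 ≤ t → x t ∈ S) ∧ (ξ ≠ 0 → ∀ t, 0 < t → V (x t) < V ξ) ∧
      (ξ = 0 → ∀ t, x t = 0) := by
    intro ξ
    by_cases hξ : ξ ∈ S
    · obtain ⟨x, h1, h2, h3⟩ := hV.exists_isSolution hF hξ.1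
      exact ⟨x, fun _ => ⟨h1, fun t ht => ⟨(h2 t ht).1, (h2 t ht).2.trans hξ.2⟩, h3⟩⟩
    · exact ⟨fun _ => 0, fun h => absurd h hξ⟩
  choose φ hφ using hex
  obtain ⟨L, f', h', hf', hh', hff', hhh'⟩ :=
    exists_common_lipschitz_extension hf hh (hS.cthickening (r := 1))
  set N := Metric.cthickening 1 S
  have hSN : S ⊆ N := Metric.self_subset_cthickening S
  -- Only the products `u_k g_k` are Lipschitz, so each product is extended as one field and given
  -- the feedback `1`.
  set u' : Fin m → EuclideanSpace ℝ (Fin d) → ℝ := fun _ _ => 1 with hu'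
  have hh1 : ∀ k, LipschitzWith L fun x => u' k x • h' k x := fun k => by simpa [hu'] using hh' k
  set F' := closedLoop f' h' u' with hF'
  have hFF' : ∀ x ∈ N, closedLoop f g u x = F' x := fun x hx => by
    simp only [hF', closedLoop, hu', one_smul]
    rw [hff' hx]
    exact congrArg _ (Finset.sum_congr rfl fun k _ => hhh' k hx)
  have hsched : ∀ τ t, ∀ x ∈ N, scheduled f' h' u' τ 0 t x = scheduled f g u τ 0 t x :=
    fun τ t x hx => by
      simp only [scheduled, hu', one_smul]
      rw [hff' hx]
      refine congrArg _ (congrArg _ (Finset.sum_congr rfl fun k _ => ?_))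
      rw [← hhh' k hx]
  have hFlip : ∀ x y, ‖F' x - F' y‖ ≤ (L + m * L) * ‖x - y‖ := fun x y =>
    norm_closedLoop_sub_le (hf'.norm_sub_le x y) fun k => (hh1 k).norm_sub_le x y
  have hFc : Continuous F' :=
    hf'.continuous.add (continuous_finsetSum _ fun k _ => (hh1 k).continuous)
  obtain ⟨M, hM0, hM⟩ := exists_norm_le_of_isCompact hFc (fun k => (hh1 k).continuous) hS
  have hφ' : ∀ ξ ∈ S, IsSolution (fun _ => F') 0 ξ (φ ξ) := fun ξ hξ =>
    (hφ ξ hξ).1.congr fun t ht => hFF' _ (hSN ((hφ ξ hξ).2.1 t ht))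
  have hφL : ∀ ξ ∈ S, ∀ ξ' ∈ S, ∀ t, 0 ≤ t →
      ‖φ ξ t - φ ξ' t‖ ≤ ‖ξ - ξ'‖ * Real.exp ((L + m * L) * t) := fun ξ hξ ξ' hξ' t ht => by
    simpa using (hφ' ξ hξ).norm_sub_le (hφ' ξ' hξ') (K := L + m * L) (by positivity) ht
      fun s _ => hFlip _ _
  have hΦc : ContinuousOn (fun ξ => φ ξ T) S := by
    refine LipschitzOnWith.continuousOn (K := (Real.exp ((L + m * L) * T)).toNNReal) ?_
    refine LipschitzOnWith.of_dist_le_mul fun ξ hξ ξ' hξ' => ?_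
    rw [dist_eq_norm, dist_eq_norm, Real.coe_toNNReal _ (Real.exp_pos _).le, mul_comm]
    exact hφL ξ hξ ξ' hξ' T hT.le
  have hU : IsOpen (basin (closedLoop f g u) ∩ V ⁻¹' Iio θ) :=
    hV.contDiffOn.continuousOn.isOpen_inter_preimage hV.isOpen_basin isOpen_Iio
  have hΦU : (fun ξ => φ ξ T) '' S ⊆ basin (closedLoop f g u) ∩ V ⁻¹' Iio θ := by
    rintro _ ⟨ξ, hξ, rfl⟩
    refine ⟨((hφ ξ hξ).2.1 T hT.le).1, ?_⟩
    by_cases h0 : ξ = 0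
    · simpa [(hφ ξ hξ).2.2.2 h0 T, hV.zero] using hθ
    · exact ((hφ ξ hξ).2.2.1 h0 T hT).trans_le hξ.2
  obtain ⟨η, hη, hηU⟩ := (hS.image_of_continuousOn hΦc).exists_cthickening_subset_open hU hΦU
  -- The averaging bound for a window of length `T`, with the factor `p` taken out.
  set C : ℝ := m * (m * M * m + m * (L * M) * m * T) * Real.exp ((L + m * (m * L)) * T) with hC
  have hC0 : 0 ≤ C := by positivity
  -- The bound `η` returns the samples to `S`; the bound `1` keeps the trajectory between samples in
  -- `N`. Dividing by `C + 1` covers `C = 0`.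
  refine ⟨min 1 η / (C + 1), by positivity, fun ξ hξ hVξ τ hτ hτc => ?_⟩
  have hCτ : ∀ t, 0 ≤ t → C * τ t ≤ min 1 η := fun t ht => by
    calc C * τ t ≤ (C + 1) * (min 1 η / (C + 1)) :=
          mul_le_mul (by linarith) (hτc t ht) (hτ.pos t ht).le (by linarith)
      _ = min 1 η := by field_simp
  obtain ⟨y, hy⟩ := exists_isSolution_scheduled hf' hh1 hτ.antitone ξ
  have hy0 : y 0 = ξ := by simpa using (hy.2 0 le_rfl).2
  have hwin : ∀ n : ℕ, y (n * T) ∈ S → ∀ q ∈ Icc (n * T) ((n + 1) * T),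
      ‖y q - φ (y (n * T)) (q - n * T)‖ ≤ C * τ (n * T) := by
    intro n hn q hq
    have hnT : (0 : ℝ) ≤ n * T := by positivity
    have hnn : (n : ℝ) * T ≤ (n + 1) * T := by gcongr; linarith
    have hφn := hφ' _ hn
    have hφs : IsSolution (fun _ => F') (n * T) (y (n * T))
        (fun t => φ (y (n * T)) (t - n * T)) := by
      have h1 := hφn.comp_add (t₁ := n * T) (s := -(n * T)) (by simp)
      have h2 : φ (y (n * T)) (n * T + -(n * T)) = y (n * T) := by
        simpa using (hφn.2 0 le_rfl).2
      rw [h2] at h1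
      simpa only [← sub_eq_add_neg] using h1
    have hxS : ∀ r ∈ Icc ((n : ℝ) * T) ((n + 1) * T), φ (y (n * T)) (r - n * T) ∈ S :=
      fun r hr => (hφ _ hn).2.1 _ (sub_nonneg.2 hr.1)
    have h1 := norm_scheduled_solution_sub_le (hτ.pos _ hnT) hm hf' hh1
      (fun r hr => hτ.piecewise_const n r hr) (hy.1.mono (fun r hr => hnT.trans hr.1))
      (hy.eq_add_integral hnT hnn).1 (fun r hr => (hy.eq_add_integral hnT hr.1).2)
      (hφs.1.mono Icc_subset_Ici_self) (fun r hr => (hφs.2 r hr.1).2)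
      (fun r hr => (hM _ (hxS r hr)).1) (fun r hr => (hM _ (hxS r hr)).2) hq
    have hqT : q - n * T ≤ T := by linarith [hq.2]
    have hτ0 := hτ.pos _ hnT
    calc _ ≤ _ := h1
      _ ≤ m * (m * M * (m * τ (n * T)) + m * (L * M) * (m * τ (n * T)) *
          ((n + 1) * T - n * T)) * Real.exp ((L + m * (m * L)) * T) := by
        have : 0 ≤ ((n : ℝ) + 1) * T - n * T := by linarith
        gcongr
      _ = C * τ (n * T) := by rw [hC]; ring
  have hnext : ∀ n : ℕ, y (n * T) ∈ S →
      ‖y ((n + 1 : ℕ) * T) - φ (y (n * T)) T‖ ≤ C * τ (n * T) := fun n hn => by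
    have h1 := hwin n hn ((n + 1) * T) ⟨by gcongr; linarith, le_rfl⟩
    rw [add_mul, one_mul, add_sub_cancel_left] at h1
    push_cast
    rwa [add_mul, one_mul]
  have hyS : ∀ n : ℕ, y (n * T) ∈ S := by
    intro n
    induction n with
    | zero => simpa [hy0] using ⟨hξ, hVξ⟩
    | succ n ih =>
      have h1 : y ((n + 1 : ℕ) * T) ∈ Metric.cthickening η ((fun ξ => φ ξ T) '' S) := by
        refine Metric.mem_cthickening_of_dist_le _ _ _ _ (mem_image_of_mem _ ih) ?_
        rw [dist_eq_norm]
        exact (hnext n ih).trans ((hCτ _ (by positivity)).trans (min_le_right _ _))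
      exact ⟨(hηU h1).1, (hηU h1).2.le⟩
  have hfloor : ∀ t, 0 ≤ t → t ∈ Icc ((⌊t / T⌋₊ : ℝ) * T) ((⌊t / T⌋₊ + 1) * T) := fun t ht =>
    ⟨(le_div_iff₀ hT).1 (Nat.floor_le (by positivity)),
      ((div_lt_iff₀ hT).1 (Nat.lt_floor_add_one _)).le⟩
  have hyN : ∀ t, 0 ≤ t → y t ∈ N := fun t ht => by
    have h1 := hfloor t ht
    refine Metric.mem_cthickening_of_dist_le _ _ _ _
      ((hφ _ (hyS ⌊t / T⌋₊)).2.1 (t - ⌊t / T⌋₊ * T) (sub_nonneg.2 h1.1)) ?_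
    rw [dist_eq_norm]
    exact (hwin _ (hyS _) t h1).trans ((hCτ _ (by positivity)).trans (min_le_left _ _))
  -- Having stayed in `N`, the solution of the extended system solves the original one.
  refine ⟨y, hy.congr fun t ht => hsched τ t _ (hyN t ht), ?_⟩
  have hτn : Tendsto (fun n : ℕ => C * τ (n * T)) atTop (𝓝 0) := by
    have h1 : Tendsto (fun n : ℕ => (n : ℝ) * T) atTop atTop :=
      tendsto_natCast_atTop_atTop.atTop_mul_const hT
    simpa using (hτ.tendsto_zero.comp h1).const_mul C
  have hz : Tendsto (fun n : ℕ => y (n * T)) atTop (𝓝 0) := by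
    refine tendsto_zero_of_asymptotic_orbit hS hΦc
      (hV.contDiffOn.continuousOn.mono fun x hx => hx.1) ((hφ 0 hS0).2.2.2 rfl T)
      (fun x hx hx0 => ?_) (fun x hx hx0 => (hφ x hx).2.2.1 hx0 T hT) hyS
      (squeeze_zero_norm (fun n => hnext n (hyS n)) hτn)
    rw [hV.zero]
    exact hV.pos x hx.1 hx0
  have hbound : Tendsto (fun n : ℕ => C * τ (n * T) +
      ‖y (n * T)‖ * Real.exp ((L + m * L) * T)) atTop (𝓝 0) := by
    simpa using hτn.add (hz.norm.mul_const (Real.exp ((L + m * L) * T)))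
  have hfl : Tendsto (fun t : ℝ => ⌊t / T⌋₊) atTop atTop :=
    tendsto_nat_floor_atTop.comp (tendsto_id.atTop_div_const hT)
  refine squeeze_zero_norm' ?_ (hbound.comp hfl)
  filter_upwards [eventually_ge_atTop 0] with t ht
  have h1 := hfloor t ht
  have h2 := hwin _ (hyS _) t h1
  -- Between samples the nominal solution is compared with the zero solution, so it is small when
  -- the sample is.
  have h3 := hφL _ (hyS ⌊t / T⌋₊) 0 hS0 (t - ⌊t / T⌋₊ * T) (sub_nonneg.2 h1.1)
  rw [(hφ 0 hS0).2.2.2 rfl, sub_zero, sub_zero] at h3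
  have h4 : t - ⌊t / T⌋₊ * T ≤ T := by linarith [h1.2]
  have h5 : ‖y (⌊t / T⌋₊ * T)‖ * Real.exp ((L + m * L) * (t - ⌊t / T⌋₊ * T)) ≤
      ‖y (⌊t / T⌋₊ * T)‖ * Real.exp ((L + m * L) * T) := by gcongr
  exact (norm_le_norm_sub_add _ _).trans (add_le_add h2 (h3.trans h5))

end RoundRobin

theorem theorem4 {d m : ℕ} (hd : 0 < d) (hm : 0 < m)
    (f : EuclideanSpace ℝ (Fin d) → EuclideanSpace ℝ (Fin d))
    (g : Fin m → EuclideanSpace ℝ (Fin d) → EuclideanSpace ℝ (Fin d))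
    (u : Fin m → EuclideanSpace ℝ (Fin d) → ℝ)
    (hf : ContDiff ℝ 1 f) (hg : ∀ k, ContDiff ℝ 1 (g k))
    (hlip : ∀ k, LocallyLipschitz (fun x => u k x • g k x))
    (hhyp : RoundRobin.IsHyperbolic (RoundRobin.closedLoop f g u))
    (hstab : RoundRobin.IsLocallyAsymptoticallyStable (RoundRobin.closedLoop f g u))
    (hC2 : ContDiffAt ℝ 2 (RoundRobin.closedLoop f g u) 0)
    (hf0 : f 0 = 0) (hu0 : ∀ k, u k 0 = 0)
    (V : EuclideanSpace ℝ (Fin d) → ℝ)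
    (hV : RoundRobin.IsLyapunovFunction (RoundRobin.closedLoop f g u) V)
    (T : ℝ) (hT : 0 < T) :
    ∀ θ : ℝ, 0 < θ → ∃ τ' : ℝ → ℝ, RoundRobin.IsSwitchingTime T τ' ∧
      ∀ t₀ : ℝ, 0 ≤ t₀ →
      ∀ ξ ∈ RoundRobin.basin (RoundRobin.closedLoop f g u), V ξ ≤ θ →
      ∀ τ : ℝ → ℝ, RoundRobin.IsSwitchingTime T τ → (∀ t, 0 ≤ t → τ t ≤ τ' t) →
        (∃ z, RoundRobin.IsSolution (RoundRobin.scheduled f g u τ t₀) t₀ ξ z) ∧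
        ∀ z, RoundRobin.IsSolution (RoundRobin.scheduled f g u τ t₀) t₀ ξ z →
          Tendsto z atTop (𝓝 0) := by
  have hfl : LocallyLipschitz f := hf.locallyLipschitz
  intro θ hθ
  obtain ⟨c, hc, H⟩ :=
    RoundRobin.exists_isSolution_tendsto_zero hm hfl hlip hstab.equilibrium hV hT hθ
  -- The only quantitative demand on `τ'` is `τ' ≤ c`; the decay used above is that of `τ` itself.
  refine ⟨_, RoundRobin.isSwitchingTime_harmonic hT hc, fun t₀ _ ξ hξ hVξ τ hτ hττ => ?_⟩
  obtain ⟨y, hy, hlim⟩ := H ξ hξ hVξ τ hτ fun t ht =>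
    (hττ t ht).trans (div_le_self hc.le (by simp))
  have hz : RoundRobin.IsSolution (RoundRobin.scheduled f g u τ t₀) t₀ ξ (fun t => y (t - t₀)) := by
    have h1 := hy.comp_add (t₁ := t₀) (s := -t₀) (by simp)
    have h2 : y (t₀ + -t₀) = ξ := by simpa using (hy.2 0 le_rfl).2
    rw [h2] at h1
    have h3 : (fun t => RoundRobin.scheduled f g u τ 0 (t + -t₀)) =
        RoundRobin.scheduled f g u τ t₀ := by
      funext t x
      simp only [RoundRobin.scheduled, sub_zero, ← sub_eq_add_neg]
    rw [h3] at h1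
    simpa only [← sub_eq_add_neg] using h1
  refine ⟨⟨_, hz⟩, fun z hz' => ?_⟩
  have hlim' : Tendsto (fun t => y (t - t₀)) atTop (𝓝 0) :=
    hlim.comp (tendsto_atTop_add_const_right _ (-t₀) tendsto_id)
  refine hlim'.congr' ?_
  filter_upwards [eventually_ge_atTop t₀] with t ht
  exact hz.eqOn_of_locallyLipschitz hfl hlip hz' ht
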